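/- Let $(X,d)$ be a metric space, let $Y\subset\mathbb{R}^m$ be nonempty and compact, and let $S$ assign to each $x\in X$ a convex compact set $S(x)\subseteq Y$ with nonempty interior in $\mathbb{R}^m$. Let $\lambda$ be the Lebesgue measure on $\mathbb{R}^m$, let $\mathbb{B}$ be the Euclidean unit ball, and let $\iota:X\to\mathcal{P}(Y)$ be the neutral belief over $S$, that is, $\iota_x(A)=\lambda(A\cap S(x))/\lambda(S(x))$ for every Borel set $A\subseteq Y$. Equip $\mathcal{P}(Y)$, the set of Borel probability measures on $Y$, with $$d_{\mathrm{TV}}(\mu,\nu)=\sup\Big\{\int f\,d\mu-\int f\,d\nu \;:\; f:Y\to\mathbb{R}\text{ measurable},\ \|f\|_\infty\le 1\Big\},$$ and the nonempty compact subsets of $Y$ with the Hausdorff distance $d_H$; continuity and Lipschitz properties of $S$ refer to $d_H$, and those of $\iota$ to $d_{\mathrm{TV}}$. For a map $f$ from $X$ to a metric space, $\mathrm{Lip}(f)\in[0,\infty]$ is the infimum of its Lipschitz constants ($\infty$ if there are none), and $\mathrm{Lip}(f,x)=\inf_{\delta>0}\mathrm{Lip}(f|_{B(x,\delta)})$, where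 $B(x,\delta)$ is the open ball; $f$ is locally Lipschitz if every $x\in X$ has a ball $B(x,\delta)$, $\delta>0$, on which $f$ is Lipschitz. Write $\mathrm{Lip}_{\mathrm{TV}}$ for these numbers when the target is $(\mathcal{P}(Y),d_{\mathrm{TV}})$. Put $$L_{Y,m}=2m\,\lambda(\mathbb{B})\left(\mathrm{diam}(Y)\sqrt{\frac{m}{2(m+1)}}\right)^{m-1}.$$ Then: 1. If $S$ is continuous, then $\iota$ is continuous. 2. If $S$ is Lipschitz, then $\iota$ is locally Lipschitz, and $$\mathrm{Lip}_{\mathrm{TV}}(\iota,x)\le\frac{2L_{Y,m}}{\lambda(S(x))}\,\mathrm{Lip}(S,x)\qquad\text{for all }x\in X.$$ 3. If $S$ is Lipschitz and $X$ is compact, then $\iota$ is Lipschitz, and, if moreover $X\neq\emptyset$, $\lambda(S(\cdot))$ attains its minimum on $X$ and $$\mathrm{Lip}_{\mathrm{TV}}(\iota)\le\frac{2L_{Y,m}\,\mathrm{Lip}(S)}{\min_{x\in X}\lambda(S(x))}.$$ -/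

import Mathlib

open MeasureTheory Filter Topology
open scoped ENNReal

noncomputable section

namespace NeutralBelief

section Lipschitz

variable {M N : Type*} [MetricSpace M]

/-- `L` is a (positive) Lipschitz constant on `A` for `f : M → N`, where distances in the target
are measured by `d`. -/
def IsLipConstOn (d : N → N → ℝ) (f : M → N) (A : Set M) (L : ℝ) : Prop :=
  0 < L ∧ ∀ x ∈ A, ∀ x' ∈ A, d (f x) (f x') ≤ L * dist x x'

/-- `f` is Lipschitz on `A` with respect to `d`. -/
def IsLipOn (d : N → N → ℝ) (f : M → N) (A : Set M) : Prop :=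
  ∃ L : ℝ, IsLipConstOn d f A L

/-- `f` is locally Lipschitz with respect to `d`: it is Lipschitz on some open ball around
each point. -/
def IsLocallyLip (d : N → N → ℝ) (f : M → N) : Prop :=
  ∀ x : M, ∃ δ : ℝ, 0 < δ ∧ IsLipOn d f (Metric.ball x δ)

/-- The infimum of the Lipschitz constants of `f` on `A`; it is `∞` if `f` is not Lipschitz
on `A`. -/
def lipOn (d : N → N → ℝ) (f : M → N) (A : Set M) : ℝ≥0∞ :=
  ⨅ (L : ℝ) (_ : IsLipConstOn d f A L), ENNReal.ofReal L

/-- The Lipschitz number `Lip(f, x)`: the infimum over `δ > 0` of the Lipschitz constants of `f`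
on the open ball `B(x, δ)`. -/
def lipAt (d : N → N → ℝ) (f : M → N) (x : M) : ℝ≥0∞ :=
  ⨅ (δ : ℝ) (_ : 0 < δ), lipOn d f (Metric.ball x δ)

/-- `f` is continuous when distances in the target are measured by `d`. -/
def IsContinuousWrt (d : N → N → ℝ) (f : M → N) : Prop :=
  ∀ x : M, Tendsto (fun x' => d (f x') (f x)) (𝓝 x) (𝓝 0)

end Lipschitz

/-- The total variation distance `sup {𝔼_μ f - 𝔼_ν f}` over measurable `f` with `‖f‖_∞ ≤ 1`. -/
def tvDist {Ω : Type*} [MeasurableSpace Ω] (μ ν : ProbabilityMeasure Ω) : ℝ :=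
  sSup {r : ℝ | ∃ f : Ω → ℝ, Measurable f ∧ (∀ y, |f y| ≤ 1) ∧
    r = (∫ y, f y ∂(μ : Measure Ω)) - ∫ y, f y ∂(ν : Measure Ω)}

/-- The constant `L_{Y,m} = 2 m λ(𝔹) (diam(Y) √(m / (2 (m + 1))))^(m - 1)`. (For `m = 0` the
truncated exponent is harmless, because of the factor `m`.) -/
def volLip (m : ℕ) (Y : Set (EuclideanSpace ℝ (Fin m))) : ℝ :=
  2 * (m : ℝ) * (volume (Metric.closedBall (0 : EuclideanSpace ℝ (Fin m)) 1)).toReal *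
    (Metric.diam Y * Real.sqrt ((m : ℝ) / (2 * ((m : ℝ) + 1)))) ^ (m - 1)

section Belief

variable {X : Type*} {m : ℕ}

/-- `S` is a set-valued map from `X` to `Y` whose values are convex and compact with nonempty
interior in `ℝ^m`. -/
structure HasConvexBodyValues (Y : Set (EuclideanSpace ℝ (Fin m)))
    (S : X → Set (EuclideanSpace ℝ (Fin m))) : Prop where
  subset : ∀ x, S x ⊆ Y
  convex : ∀ x, Convex ℝ (S x)
  isCompact : ∀ x, IsCompact (S x)
  nonempty_interior : ∀ x, (interior (S x)).Nonempty

/-- The measure `A ↦ λ(A ∩ C) / λ(C)` on the Borel subsets `A` of `Y`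
(see `uniformMeasure_apply`). -/
def uniformMeasure (Y C : Set (EuclideanSpace ℝ (Fin m))) : Measure Y :=
  (volume C)⁻¹ • Measure.comap ((↑) : Y → EuclideanSpace ℝ (Fin m)) (volume.restrict C)

theorem uniformMeasure_apply {Y C : Set (EuclideanSpace ℝ (Fin m))} (hY : IsCompact Y)
    {A : Set Y} (hA : MeasurableSet A) :
    uniformMeasure Y C A = volume (((↑) : Y → EuclideanSpace ℝ (Fin m)) '' A ∩ C) / volume C := by
  have hA' := hY.measurableSet.subtype_image hA
  rw [uniformMeasure, Measure.smul_apply, smul_eq_mul,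
    comap_subtype_coe_apply hY.measurableSet, Measure.restrict_apply hA', div_eq_mul_inv, mul_comm]

theorem HasConvexBodyValues.isProbabilityMeasure {Y : Set (EuclideanSpace ℝ (Fin m))}
    {S : X → Set (EuclideanSpace ℝ (Fin m))} (hY : IsCompact Y) (hS : HasConvexBodyValues Y S)
    (x : X) : IsProbabilityMeasure (uniformMeasure Y (S x)) := by
  refine ⟨?_⟩
  rw [uniformMeasure_apply hY MeasurableSet.univ, Set.image_univ, Subtype.range_coe,
    Set.inter_eq_right.2 (hS.subset x)]
  exact ENNReal.div_self (Measure.measure_pos_of_nonempty_interior _ (hS.nonempty_interior x)).ne'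
    (hS.isCompact x).measure_lt_top.ne

/-- The neutral belief `ι : X → 𝒫(Y)` over `S`: `ι_x` is the uniform distribution on `S x`. As
`S x` has nonempty interior, its affine hull is `ℝ^m`, and the reference measure is the Lebesgue
measure. -/
def neutralBelief {Y : Set (EuclideanSpace ℝ (Fin m))}
    {S : X → Set (EuclideanSpace ℝ (Fin m))} (hY : IsCompact Y) (hS : HasConvexBodyValues Y S) :
    X → ProbabilityMeasure Y :=
  fun x => ⟨uniformMeasure Y (S x), hS.isProbabilityMeasure hY x⟩

end Belief

end NeutralBelief

end

/-! Everything rests on one volume estimate: convex bodies `A`, `B` in `Y` at Hausdorff distance `h`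
satisfy `λ(A \ B) ≤ L h` with `L = volLip m Y` (`volume_real_diff_le`). Averages over `A` and `B` of
a function bounded by 1 differ by at most `2 λ(A \ B) / λ(A)` when `A` is the larger body, so the
total variation distance of the beliefs is at most `2 L h` divided by the larger volume. Continuity,
the local bound and the global bound follow by bounding that volume from below: by `λ(S x)`, by
numbers increasing to it near `x`, or by the minimum over a compact `X`.

For the volume estimate, `A ⊆ B + h𝔹`, so `λ(A \ B) ≤ λ(B + h𝔹) - λ(B)`. This gain is monotone in
the convex body `B`. For a segment in place of `h𝔹` this is seen along the lines parallel to the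
segment; iteration gives zonotopes, and the ball is a limit of zonotopes (`volume_add_zonotope_le`,
`exists_zonotope_approx_closedBall`). Hence `B` may be replaced by a ball containing `Y`, whose
radius `R` comes from Jung's theorem, and `(R + h)^m - R^m` is at most twice its first-order term
when `h` is small. When `h` is large, the volume of the Jung ball is already a sufficient bound. -/

namespace NeutralBelief

open scoped Pointwise RealInnerProductSpace

/-! ### Jung's theorem -/

section Jung

variable {E : Type*} [NormedAddCommGroup E] [InnerProductSpace ℝ E]

/-- The variance of a finite weighted family of points, written with pairwise distances. -/
theorem sum_sum_mul_norm_sub_sq {ι : Type*} [Fintype ι] (p : ι → E) (w : ι → ℝ)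
    (hw : ∑ i, w i = 1) :
    ∑ i, ∑ j, w i * w j * ‖p i - p j‖ ^ 2 =
      2 * (∑ i, w i * ‖p i‖ ^ 2 - ‖∑ i, w i • p i‖ ^ 2) := by
  have h1 : ‖∑ i, w i • p i‖ ^ 2 = ∑ i, ∑ j, w i * w j * ⟪p i, p j⟫ := by
    rw [← real_inner_self_eq_norm_sq, sum_inner]
    refine Finset.sum_congr rfl fun i _ => ?_
    rw [inner_sum]
    refine Finset.sum_congr rfl fun j _ => ?_
    rw [real_inner_smul_left, real_inner_smul_right]; ring
  have h2 : ∑ i, w i * ‖p i‖ ^ 2 = ∑ i, ∑ j, w i * w j * ‖p i‖ ^ 2 := by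
    refine Finset.sum_congr rfl fun i _ => ?_
    rw [← Finset.sum_mul, ← Finset.mul_sum, hw, mul_one]
  have h3 : ∑ i, w i * ‖p i‖ ^ 2 = ∑ i, ∑ j, w i * w j * ‖p j‖ ^ 2 := by
    rw [Finset.sum_comm]
    refine Finset.sum_congr rfl fun i _ => ?_
    rw [← Finset.sum_mul, ← Finset.sum_mul, hw, one_mul]
  have h4 : 2 * (∑ i, w i * ‖p i‖ ^ 2 - ‖∑ i, w i • p i‖ ^ 2) =
      ∑ i, ∑ j, w i * w j * ‖p i‖ ^ 2 + ∑ i, ∑ j, w i * w j * ‖p j‖ ^ 2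
        - 2 * ∑ i, ∑ j, w i * w j * ⟪p i, p j⟫ := by
    rw [← h2, ← h3, ← h1]; ring
  rw [h4, Finset.mul_sum, ← Finset.sum_add_distrib, ← Finset.sum_sub_distrib]
  refine Finset.sum_congr rfl fun i _ => ?_
  rw [Finset.mul_sum, ← Finset.sum_add_distrib, ← Finset.sum_sub_distrib]
  refine Finset.sum_congr rfl fun j _ => ?_
  rw [norm_sub_sq_real]; ring

/-- Jung's theorem for a finite family: the centre is the barycentre of maximal variance. -/
theorem exists_forall_norm_sub_sq_le {ι : Type*} [Fintype ι] [Nonempty ι] (p : ι → E) {D : ℝ}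
    (hD : ∀ i j, ‖p i - p j‖ ≤ D) :
    ∃ c : E, ∀ i, ‖p i - c‖ ^ 2 ≤ D ^ 2 / 2 * (1 - 1 / (Fintype.card ι : ℝ)) := by
  classical
  set F : (ι → ℝ) → ℝ := fun w => ∑ i, w i * ‖p i‖ ^ 2 - ‖∑ i, w i • p i‖ ^ 2 with hF
  have hFc : Continuous F := by fun_prop
  obtain ⟨w, hw, hmax⟩ := (isCompact_stdSimplex ℝ ι).exists_isMaxOn
    ⟨_, single_mem_stdSimplex ℝ (Classical.arbitrary ι)⟩ hFc.continuousOn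
  have hD0 : 0 ≤ D := (norm_nonneg _).trans (hD (Classical.arbitrary ι) (Classical.arbitrary ι))
  have hcard : (0 : ℝ) < Fintype.card ι := by exact_mod_cast Fintype.card_pos
  have hFw : F w ≤ D ^ 2 / 2 * (1 - 1 / (Fintype.card ι : ℝ)) := by
    have h1 := sum_sum_mul_norm_sub_sq p w hw.2
    -- The diagonal terms vanish, so only the off-diagonal mass `1 - ∑ w i ^ 2` counts; by
    -- Cauchy–Schwarz it is at most `1 - 1 / card ι`.
    have h2 : ∑ i, ∑ j, w i * w j * ‖p i - p j‖ ^ 2 ≤ D ^ 2 * (1 - ∑ i, w i ^ 2) := by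
      have h3 : D ^ 2 * (1 - ∑ i, w i ^ 2) =
          ∑ i, ∑ j, (w i * w j * D ^ 2 - if i = j then w i ^ 2 * D ^ 2 else 0) := by
        have h4 : ∀ i, ∑ j, (w i * w j * D ^ 2 - if i = j then w i ^ 2 * D ^ 2 else 0) =
            w i * D ^ 2 - w i ^ 2 * D ^ 2 := by
          intro i
          rw [Finset.sum_sub_distrib, ← Finset.sum_mul, ← Finset.mul_sum, hw.2]
          simp
        simp_rw [h4]
        rw [Finset.sum_sub_distrib, ← Finset.sum_mul, ← Finset.sum_mul, hw.2]; ring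
      rw [h3]
      refine Finset.sum_le_sum fun i _ => Finset.sum_le_sum fun j _ => ?_
      split_ifs with hij
      · subst hij
        simp [sq]
      · rw [sub_zero]
        exact mul_le_mul_of_nonneg_left (pow_le_pow_left₀ (norm_nonneg _) (hD i j) 2)
          (mul_nonneg (hw.1 i) (hw.1 j))
    have h5 : 1 / (Fintype.card ι : ℝ) ≤ ∑ i, w i ^ 2 := by
      have := sq_sum_le_card_mul_sum_sq (s := Finset.univ) (f := w)
      rw [hw.2, one_pow, Finset.card_univ] at this
      rw [div_le_iff₀ hcard]; linarith
    have h6 : D ^ 2 * (1 - ∑ i, w i ^ 2) ≤ D ^ 2 * (1 - 1 / (Fintype.card ι : ℝ)) :=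
      mul_le_mul_of_nonneg_left (by linarith) (sq_nonneg D)
    change ∑ i, w i * ‖p i‖ ^ 2 - ‖∑ i, w i • p i‖ ^ 2 ≤ _
    linarith
  refine ⟨∑ i, w i • p i, fun j => le_trans ?_ hFw⟩
  set c := ∑ i, w i • p i with hc
  -- First-order optimality of `w` towards the vertex `j`: along that segment `F` changes by `t (‖p
  -- j - c‖² - F w) - t² ‖p j - c‖²`, which cannot be positive.
  have key : ∀ t : ℝ, 0 < t → t ≤ 1 → ‖p j - c‖ ^ 2 - F w ≤ t * ‖p j - c‖ ^ 2 := by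
    intro t ht0 ht1
    have hmem : (1 - t) • w + t • (Pi.single j 1 : ι → ℝ) ∈ stdSimplex ℝ ι :=
      convex_stdSimplex ℝ ι hw (single_mem_stdSimplex ℝ j) (by linarith) ht0.le (by ring)
    have h1 := hmax hmem
    have h2 : ∑ i, ((1 - t) • w + t • (Pi.single j 1 : ι → ℝ)) i * ‖p i‖ ^ 2 =
        (1 - t) * ∑ i, w i * ‖p i‖ ^ 2 + t * ‖p j‖ ^ 2 := by
      simp only [Pi.add_apply, Pi.smul_apply, smul_eq_mul, add_mul, Finset.sum_add_distrib,
        mul_assoc, ← Finset.mul_sum]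
      simp [Pi.single_apply]
    have h3 : ∑ i, ((1 - t) • w + t • (Pi.single j 1 : ι → ℝ)) i • p i =
        c + t • (p j - c) := by
      simp only [Pi.add_apply, Pi.smul_apply, smul_eq_mul, add_smul, Finset.sum_add_distrib,
        mul_smul, ← Finset.smul_sum, ← hc]
      simp only [Pi.single_apply, ite_smul, one_smul, zero_smul, Finset.sum_ite_eq',
        Finset.mem_univ, if_true]
      module
    have h4 : ‖c + t • (p j - c)‖ ^ 2 =
        ‖c‖ ^ 2 + 2 * t * (⟪c, p j⟫ - ‖c‖ ^ 2) + t ^ 2 * ‖p j - c‖ ^ 2 := by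
      rw [norm_add_sq_real, norm_smul, mul_pow, real_inner_smul_right, inner_sub_right,
        real_inner_self_eq_norm_sq, Real.norm_eq_abs, sq_abs]
      ring
    have h5 : ‖p j - c‖ ^ 2 = ‖p j‖ ^ 2 - 2 * ⟪c, p j⟫ + ‖c‖ ^ 2 := by
      rw [norm_sub_sq_real, real_inner_comm]
    have h6 : F w = ∑ i, w i * ‖p i‖ ^ 2 - ‖c‖ ^ 2 := rfl
    simp only [Set.mem_ofPred_eq, hF, h2, h3, h4] at h1
    rw [← hc] at h1
    have h7 : t * (‖p j - c‖ ^ 2 - F w) ≤ t * (t * ‖p j - c‖ ^ 2) := by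
      rw [h6]
      nlinarith
    exact le_of_mul_le_mul_left h7 ht0
  -- In place of the limit `t → 0`, an explicit `t` small enough to contradict `key`.
  by_contra! hlt
  have hG : 0 ≤ ‖p j - c‖ ^ 2 := sq_nonneg _
  set G := ‖p j - c‖ ^ 2
  have hx : 0 < G - F w := by linarith
  have hden : 0 < G - F w + G + 1 := by linarith
  have := key ((G - F w) / (G - F w + G + 1)) (by positivity)
    ((div_le_one hden).2 (by linarith))
  rw [div_mul_eq_mul_div, le_div_iff₀ hden] at this
  nlinarith

/-- **Jung's theorem**: a bounded set of diameter `D` in an `m`-dimensional Euclidean space lies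
in a closed ball of radius `D √(m / (2 (m + 1)))`. -/
theorem exists_subset_closedBall_jung [FiniteDimensional ℝ E] {Y : Set E}
    (hY : Bornology.IsBounded Y) :
    ∃ c : E, Y ⊆ Metric.closedBall c (Metric.diam Y *
      Real.sqrt ((Module.finrank ℝ E : ℝ) / (2 * ((Module.finrank ℝ E : ℝ) + 1)))) := by
  set m := Module.finrank ℝ E
  set D := Metric.diam Y
  set R := D * Real.sqrt ((m : ℝ) / (2 * ((m : ℝ) + 1))) with hR
  have hD0 : 0 ≤ D := Metric.diam_nonneg
  have hR0 : 0 ≤ R := by positivity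
  -- A centre is a common point of the balls of radius `R` around the points of `Y`. By Helly's
  -- theorem at most `m + 1` balls need to be considered at a time.
  have hne : (⋂ y : Y, Metric.closedBall (y : E) R).Nonempty := by
    refine Convex.helly_theorem_compact' (𝕜 := ℝ) (fun y => convex_closedBall _ _)
      (fun y => isCompact_closedBall _ _) fun I hI => ?_
    rcases I.eq_empty_or_nonempty with rfl | hIne
    · simp
    have : Nonempty I := hIne.to_subtype
    obtain ⟨c, hc⟩ := exists_forall_norm_sub_sq_le (fun i : I => ((i : Y) : E)) (D := D)
      (fun i j => by
        rw [← dist_eq_norm]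
        exact Metric.dist_le_diam_of_mem hY i.1.2 j.1.2)
    refine ⟨c, Set.mem_iInter₂.2 fun y hy => ?_⟩
    rw [Metric.mem_closedBall, dist_comm, dist_eq_norm]
    refine le_of_sq_le_sq ?_ hR0
    refine (hc ⟨y, hy⟩).trans ?_
    have hcard : (0 : ℝ) < Fintype.card I := by exact_mod_cast Fintype.card_pos
    have hcard' : (Fintype.card I : ℝ) ≤ m + 1 := by
      rw [Fintype.card_coe]; exact_mod_cast hI
    have hm : (0 : ℝ) < (m : ℝ) + 1 := by positivity
    rw [hR, mul_pow, Real.sq_sqrt (by positivity)]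
    have h1 : 1 / ((m : ℝ) + 1) ≤ 1 / (Fintype.card I : ℝ) :=
      one_div_le_one_div_of_le hcard hcard'
    have h2 : (m : ℝ) / (2 * ((m : ℝ) + 1)) = (1 - 1 / ((m : ℝ) + 1)) / 2 := by
      field_simp; ring
    rw [h2, div_mul_eq_mul_div, mul_div_assoc]
    gcongr
  obtain ⟨c, hc⟩ := hne
  refine ⟨c, fun y hy => ?_⟩
  rw [Metric.mem_closedBall, dist_comm]
  exact Metric.mem_closedBall.1 (Set.mem_iInter.1 hc ⟨y, hy⟩)

end Jung

/-! ### Adding zonotopes to convex bodies, and approximating the ball by zonotopes -/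

section Zonotope

/-- If `P` meets every orbit of the translations by multiples of `u` at most once, and `Q` meets
every orbit that `P` meets, then `P` is not larger than `Q`. -/
theorem measure_le_of_translates {E : Type*} [AddCommGroup E] [MeasurableSpace E]
    [MeasurableAdd E] (μ : Measure E) [μ.IsAddRightInvariant] {P Q : Set E}
    (hP : MeasurableSet P) (hQ : MeasurableSet Q) (u : E)
    (hdisj : ∀ x ∈ P, ∀ k : ℤ, k ≠ 0 → x + k • u ∉ P)
    (hcov : ∀ x ∈ P, ∃ k : ℤ, x + k • u ∈ Q) : μ P ≤ μ Q := by
  -- `W k` is the part of `Q` reached from `P` by the shift `k • u`. These parts are disjoint, and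
  -- shifting them back covers `P`.
  set W : ℤ → Set E := fun k => Q ∩ (fun y => y + (-k) • u) ⁻¹' P with hW
  have hWm : ∀ k, MeasurableSet (W k) := fun k =>
    hQ.inter (measurable_add_const _ hP)
  have hsub : P ⊆ ⋃ k : ℤ, (fun y => y + k • u) ⁻¹' W k := by
    intro x hx
    obtain ⟨k, hk⟩ := hcov x hx
    refine Set.mem_iUnion.2 ⟨k, hk, ?_⟩
    simpa [add_assoc] using hx
  have hdis : Pairwise (Function.onFun Disjoint W) := by
    intro k l hkl
    refine Set.disjoint_left.2 fun y hy hy' => ?_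
    refine hdisj _ hy.2 (k - l) (sub_ne_zero.2 hkl) ?_
    have : y + -k • u + (k - l) • u = y + -l • u := by
      rw [add_assoc, ← add_smul]; congr 2; ring
    rw [this]
    exact hy'.2
  calc μ P ≤ μ (⋃ k : ℤ, (fun y => y + k • u) ⁻¹' W k) := measure_mono hsub
    _ ≤ ∑' k : ℤ, μ ((fun y => y + k • u) ⁻¹' W k) := measure_iUnion_le _
    _ = ∑' k : ℤ, μ (W k) := by simp_rw [measure_preimage_add_right]
    _ = μ (⋃ k, W k) := (measure_iUnion hdis hWm).symm
    _ ≤ μ Q := measure_mono (Set.iUnion_subset fun k => Set.inter_subset_left)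

theorem mem_add_segment_zero {E : Type*} [AddCommGroup E] [Module ℝ E] {K : Set E} {u x : E} :
    x ∈ K + segment ℝ 0 u ↔ ∃ s : ℝ, 0 ≤ s ∧ s ≤ 1 ∧ x - s • u ∈ K := by
  rw [Set.mem_add, segment_eq_image]
  constructor
  · rintro ⟨y, hy, _, ⟨s, hs, rfl⟩, rfl⟩
    exact ⟨s, hs.1, hs.2, by simpa using hy⟩
  · rintro ⟨s, h0, h1, h⟩
    exact ⟨_, h, s • u, ⟨s, ⟨h0, h1⟩, by simp⟩, by simp⟩

variable {E : Type*} [NormedAddCommGroup E] [InnerProductSpace ℝ E]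

theorem isCompact_segment (u v : E) : IsCompact (segment ℝ u v) := by
  rw [segment_eq_image]
  exact isCompact_Icc.image (by fun_prop)

theorem isCompact_zonotope {ι : Type*} (s : Finset ι) (a b : ι → E) :
    IsCompact (∑ i ∈ s, segment ℝ (a i) (b i)) := by
  classical
  induction s using Finset.induction_on with
  | empty => simp
  | insert i s hi ih =>
    rw [Finset.sum_insert hi]
    exact (isCompact_segment _ _).add ih

theorem convex_zonotope {ι : Type*} (s : Finset ι) (a b : ι → E) :
    Convex ℝ (∑ i ∈ s, segment ℝ (a i) (b i)) := by
  classical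
  induction s using Finset.induction_on with
  | empty => exact convex_singleton (0 : E)
  | insert i s hi ih =>
    rw [Finset.sum_insert hi]
    exact (convex_segment _ _).add ih

/-- The sum `∑ |⟪u i, v⟫|` is the support function of the zonotope at `v`; testing it with `v` equal
to a point of the zonotope bounds the norm of that point. -/
theorem zonotope_subset_closedBall {ι : Type*} (s : Finset ι) (u : ι → E) {C : ℝ} (hC : 0 ≤ C)
    (h : ∀ v : E, ∑ i ∈ s, |⟪u i, v⟫| ≤ C * ‖v‖) :
    ∑ i ∈ s, segment ℝ (-u i) (u i) ⊆ Metric.closedBall 0 C := by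
  intro z hz
  obtain ⟨g, hg, rfl⟩ := (Set.mem_finsetSum _ _ _).1 hz
  set z := ∑ i ∈ s, g i with hzdef
  have h1 : ‖z‖ ^ 2 ≤ C * ‖z‖ := by
    refine le_trans ?_ (h z)
    rw [← real_inner_self_eq_norm_sq]
    nth_rewrite 1 [hzdef]
    rw [sum_inner]
    refine Finset.sum_le_sum fun i hi => ?_
    obtain ⟨a, b, ha, hb, hab, hgi⟩ := hg hi
    rw [← hgi, inner_add_left, real_inner_smul_left, real_inner_smul_left, inner_neg_left]
    have h2 := mul_le_mul_of_nonneg_left (neg_le_abs ⟪u i, z⟫) ha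
    have h3 := mul_le_mul_of_nonneg_left (le_abs_self ⟪u i, z⟫) hb
    have h4 : |⟪u i, z⟫| = a * |⟪u i, z⟫| + b * |⟪u i, z⟫| := by rw [← add_mul, hab, one_mul]
    linarith
  rw [mem_closedBall_zero_iff]
  rcases eq_or_lt_of_le (norm_nonneg z) with h0 | h0
  · rw [← h0]; exact hC
  · rw [sq] at h1
    exact le_of_mul_le_mul_right h1 h0

variable [FiniteDimensional ℝ E]

/-- A point outside the zonotope is strictly separated from it by some `v`. The vertex with signs
adapted to `v` attains the support function, which is at least `‖v‖`. -/
theorem closedBall_subset_zonotope {ι : Type*} (s : Finset ι) (u : ι → E)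
    (h : ∀ v : E, ‖v‖ ≤ ∑ i ∈ s, |⟪u i, v⟫|) :
    Metric.closedBall 0 1 ⊆ ∑ i ∈ s, segment ℝ (-u i) (u i) := by
  intro x hx
  by_contra hxZ
  obtain ⟨f, r, hf, hr⟩ := geometric_hahn_banach_closed_point (convex_zonotope s _ _)
    (isCompact_zonotope s _ _).isClosed hxZ
  set v := (InnerProductSpace.toDual ℝ E).symm f with hv
  have hfv : ∀ y, f y = ⟪v, y⟫ := fun y => by
    rw [hv, InnerProductSpace.toDual_symm_apply]
  have h1 : ∑ i ∈ s, (if 0 ≤ ⟪v, u i⟫ then u i else -u i) ∈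
      ∑ i ∈ s, segment ℝ (-u i) (u i) := by
    refine Set.finsetSum_mem_finsetSum _ _ _ fun i _ => ?_
    split_ifs
    · exact right_mem_segment _ _ _
    · exact left_mem_segment _ _ _
  have h2 := hf _ h1
  have h3 : f (∑ i ∈ s, (if 0 ≤ ⟪v, u i⟫ then u i else -u i)) = ∑ i ∈ s, |⟪u i, v⟫| := by
    rw [map_sum]
    refine Finset.sum_congr rfl fun i _ => ?_
    rw [hfv, real_inner_comm v (u i)]
    split_ifs with h
    · rw [abs_of_nonneg h]
    · rw [inner_neg_right, abs_of_neg (not_le.1 h)]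
  have h4 : f x ≤ ‖v‖ := by
    rw [hfv]
    refine (real_inner_le_norm _ _).trans ?_
    exact mul_le_of_le_one_right (norm_nonneg _) (by simpa using hx)
  linarith [h v]

variable [MeasurableSpace E] [BorelSpace E]

/-- The volume gained by adding a segment to a convex body grows with the body. -/
theorem volume_add_segment_zero_le {K Q : Set E} (hK : IsCompact K) (hQ : IsCompact Q)
    (hKc : Convex ℝ K) (hKQ : K ⊆ Q) (u : E) :
    volume (K + segment ℝ 0 u) + volume Q ≤ volume (Q + segment ℝ 0 u) + volume K := by
  rcases eq_or_ne u 0 with rfl | hu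
  · simp [add_comm]
  have hseg := isCompact_segment (0 : E) u
  have hle : volume ((K + segment ℝ 0 u) \ K) ≤ volume ((Q + segment ℝ 0 u) \ Q) := by
    refine measure_le_of_translates volume
      ((hK.add hseg).measurableSet.diff hK.measurableSet)
      ((hQ.add hseg).measurableSet.diff hQ.measurableSet) u ?_ ?_
    -- If both points were in the difference, `x` would lie between `x - s • u` and `x + (r - t) •
    -- u`, which belong to `K` because `t ≤ 1 ≤ r`; convexity would put `x` in `K`.
    · have key : ∀ x, x ∈ (K + segment ℝ 0 u) \ K → ∀ r : ℝ, 1 ≤ r →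
          x + r • u ∉ (K + segment ℝ 0 u) \ K := by
        rintro x ⟨hx, hxK⟩ r hr ⟨hx', -⟩
        obtain ⟨s, hs0, hs1, hs⟩ := mem_add_segment_zero.1 hx
        obtain ⟨t, ht0, ht1, ht⟩ := mem_add_segment_zero.1 hx'
        apply hxK
        rcases eq_or_lt_of_le hs0 with rfl | hs0
        · simpa using hs
        have hpos : 0 < s + (r - t) := by linarith
        have := hKc hs ht (a := (r - t) / (s + (r - t))) (b := s / (s + (r - t)))
          (div_nonneg (by linarith) hpos.le) (div_nonneg hs0.le hpos.le)
          (by rw [← add_div, add_comm, div_self hpos.ne'])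
        convert this using 1
        have h1 : (r - t) / (s + (r - t)) + s / (s + (r - t)) = 1 := by
          rw [← add_div, add_comm, div_self hpos.ne']
        have h2 : (r - t) / (s + (r - t)) * (-s) + s / (s + (r - t)) * (r - t) = 0 := by
          ring
        calc x = (1 : ℝ) • x + (0 : ℝ) • u := by simp
          _ = _ := by rw [← h1, ← h2]; module
      intro x hx k hk hxk
      rcases lt_or_gt_of_ne hk with hk | hk
      · have h1 : (1 : ℝ) ≤ (-k : ℤ) := by exact_mod_cast (by omega : 1 ≤ -k)
        refine key _ hxk _ h1 ?_
        rw [← Int.cast_smul_eq_zsmul ℝ, add_assoc, ← add_smul]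
        simpa using hx
      · have h1 : (1 : ℝ) ≤ (k : ℤ) := by exact_mod_cast (by omega : 1 ≤ k)
        refine key _ hx _ h1 ?_
        rwa [Int.cast_smul_eq_zsmul ℝ]
    · rintro x ⟨hx, -⟩
      obtain ⟨s, hs0, hs1, hs⟩ := mem_add_segment_zero.1 hx
      -- Steps of `u` from `x` eventually leave the bounded set `Q`. At the first exit the preceding
      -- point is in `Q`, or no step was needed and `x - s • u ∈ K ⊆ Q`; either way the exit point
      -- is in `Q + [0, u]`.
      have hex : ∃ n : ℕ, x + (n : ℝ) • u ∉ Q := by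
        obtain ⟨C, hC⟩ := hQ.isBounded.exists_norm_le
        have hun : 0 < ‖u‖ := norm_pos_iff.2 hu
        obtain ⟨n, hn⟩ := exists_nat_gt ((C + ‖x‖) / ‖u‖)
        refine ⟨n, fun h => ?_⟩
        have h1 := hC _ h
        have h2 : ‖(n : ℝ) • u‖ ≤ ‖x + (n : ℝ) • u‖ + ‖x‖ := by
          have := norm_sub_le (x + (n : ℝ) • u) x
          rwa [add_sub_cancel_left] at this
        rw [norm_smul, Real.norm_natCast] at h2
        rw [div_lt_iff₀ hun] at hn
        linarith
      classical
      have hspec := Nat.find_spec hex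
      refine ⟨(Nat.find hex : ℕ), ?_⟩
      rw [natCast_zsmul, ← Nat.cast_smul_eq_nsmul ℝ]
      refine ⟨mem_add_segment_zero.2 ?_, hspec⟩
      rcases Nat.eq_zero_or_pos (Nat.find hex) with h0 | h0
      · refine ⟨s, hs0, hs1, ?_⟩
        rw [h0]
        simpa using hKQ hs
      · refine ⟨1, zero_le_one, le_rfl, ?_⟩
        have h1 := Nat.find_min hex (Nat.sub_lt h0 one_pos)
        rw [not_not, Nat.cast_pred h0] at h1
        convert h1 using 1
        module
  have hsub : ∀ C : Set E, C ⊆ C + segment ℝ 0 u := fun C =>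
    Set.subset_add_left C (left_mem_segment ℝ 0 u)
  have h1 := measure_inter_add_sdiff (μ := volume) (K + segment ℝ 0 u) hK.measurableSet
  have h2 := measure_inter_add_sdiff (μ := volume) (Q + segment ℝ 0 u) hQ.measurableSet
  rw [Set.inter_eq_right.2 (hsub _)] at h1 h2
  rw [← h1, ← h2]
  calc volume K + volume ((K + segment ℝ 0 u) \ K) + volume Q
      = volume Q + volume ((K + segment ℝ 0 u) \ K) + volume K := by ring
    _ ≤ _ := by gcongr

theorem volume_add_segment_le {K Q : Set E} (hK : IsCompact K) (hQ : IsCompact Q)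
    (hKc : Convex ℝ K) (hKQ : K ⊆ Q) (a b : E) :
    volume (K + segment ℝ a b) + volume Q ≤ volume (Q + segment ℝ a b) + volume K := by
  have h : ∀ C : Set E, volume (C + segment ℝ a b) = volume (C + segment ℝ 0 (b - a)) := by
    intro C
    have h1 : segment ℝ a b = segment ℝ 0 (b - a) + {a} := by
      rw [Set.add_singleton]
      have := segment_translate_image ℝ a 0 (b - a)
      simp only [add_zero, add_sub_cancel] at this
      rw [← this]
      simp_rw [add_comm]
    rw [h1, ← add_assoc, Set.add_singleton, Set.image_add_right, measure_preimage_add_right]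
  rw [h, h]
  exact volume_add_segment_zero_le hK hQ hKc hKQ _

/-- The volume gained by adding a zonotope to a convex body grows with the body. -/
theorem volume_add_zonotope_le {ι : Type*} (s : Finset ι) (a b : ι → E) {K Q : Set E}
    (hK : IsCompact K) (hQ : IsCompact Q) (hKc : Convex ℝ K) (hQc : Convex ℝ Q) (hKQ : K ⊆ Q) :
    volume (K + ∑ i ∈ s, segment ℝ (a i) (b i)) + volume Q ≤
      volume (Q + ∑ i ∈ s, segment ℝ (a i) (b i)) + volume K := by
  classical
  induction s using Finset.induction_on generalizing K Q with
  | empty => simp [add_comm]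
  | insert i s hi ih =>
    rw [Finset.sum_insert hi, ← add_assoc, ← add_assoc]
    have hseg := isCompact_segment (a i) (b i)
    have h1 := ih (hK.add hseg) (hQ.add hseg) (hKc.add (convex_segment _ _))
      (hQc.add (convex_segment _ _)) (Set.add_subset_add_right hKQ)
    have h2 := volume_add_segment_le hK hQ hKc hKQ (a i) (b i)
    have hf1 : volume (K + segment ℝ (a i) (b i)) ≠ ∞ := (hK.add hseg).measure_lt_top.ne
    have hf2 : volume (Q + segment ℝ (a i) (b i)) ≠ ∞ := (hQ.add hseg).measure_lt_top.ne
    -- The two inequalities telescope; the intermediate volumes cancel because they are finite.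
    refine (ENNReal.add_le_add_iff_right (ENNReal.add_ne_top.2 ⟨hf1, hf2⟩)).1 ?_
    calc _ = (volume (K + segment ℝ (a i) (b i) + ∑ i ∈ s, segment ℝ (a i) (b i))
              + volume (Q + segment ℝ (a i) (b i))) +
              (volume (K + segment ℝ (a i) (b i)) + volume Q) := by ring
      _ ≤ _ := add_le_add h1 h2
      _ = _ := by ring

/-- The reflection taking `v` to `w` preserves both volume and the unit ball. -/
theorem integral_ball_abs_inner_congr {v w : E} (h : ‖v‖ = ‖w‖) :
    ∫ x in Metric.ball (0 : E) 1, |⟪x, v⟫| = ∫ x in Metric.ball (0 : E) 1, |⟪x, w⟫| := by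
  set T := (ℝ ∙ (v - w))ᗮ.reflection with hT
  have hTv : T v = w := Submodule.reflection_sub h
  have h1 := (LinearIsometryEquiv.measurePreserving T).setIntegral_preimage_emb
    T.toHomeomorph.measurableEmbedding (fun x => |⟪x, w⟫|) (Metric.ball (0 : E) 1)
  have h2 : T ⁻¹' Metric.ball (0 : E) 1 = Metric.ball 0 1 := by
    rw [T.preimage_ball]; simp
  rw [h2] at h1
  rw [← h1]
  congr 1
  funext x
  rw [← hTv, LinearIsometryEquiv.inner_map_map]

/-- The integral of `|⟨x, v⟩|` over the unit ball is a positive multiple of `‖v‖`. -/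
theorem exists_integral_ball_abs_inner_eq [Nontrivial E] :
    ∃ c : ℝ, 0 < c ∧ ∀ v : E, ∫ x in Metric.ball (0 : E) 1, |⟪x, v⟫| = c * ‖v‖ := by
  obtain ⟨e, he⟩ := exists_norm_eq E zero_le_one
  refine ⟨∫ x in Metric.ball (0 : E) 1, |⟪x, e⟫|, ?_, fun v => ?_⟩
  · rw [setIntegral_pos_iff_support_of_nonneg_ae]
    · refine (IsOpen.inter ?_ Metric.isOpen_ball).measure_pos volume ?_
      · exact (by fun_prop : Continuous fun x : E => |⟪x, e⟫|).isOpen_support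
      · refine ⟨(1 / 2 : ℝ) • e, ?_, ?_⟩
        · simp [real_inner_smul_left, he]
        · rw [mem_ball_zero_iff, norm_smul, he]; norm_num
    · exact Eventually.of_forall fun x => abs_nonneg _
    · exact ((by fun_prop : Continuous fun x : E => |⟪x, e⟫|).continuousOn.integrableOn_compact
        (isCompact_closedBall 0 1)).mono_set Metric.ball_subset_closedBall
  · have h1 : ‖v‖ = ‖‖v‖ • e‖ := by simp [norm_smul, he]
    rw [integral_ball_abs_inner_congr h1, ← integral_mul_const]
    congr 1
    funext x
    rw [real_inner_smul_right, abs_mul, abs_norm, mul_comm]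

/-- The unit ball is a limit of zonotopes. -/
theorem exists_zonotope_approx_closedBall {ε : ℝ} (hε : 0 < ε) :
    ∃ (s : Finset E) (u : E → E),
      Metric.closedBall 0 1 ⊆ ∑ i ∈ s, segment ℝ (-u i) (u i) ∧
      ∑ i ∈ s, segment ℝ (-u i) (u i) ⊆ Metric.closedBall 0 (1 + ε) := by
  rcases subsingleton_or_nontrivial E with hE | hE
  · exact ⟨∅, id, fun x _ => by simpa using Subsingleton.elim x 0,
      fun x _ => by rw [Subsingleton.elim x 0]; simpa using by positivity⟩
  obtain ⟨c, hc, hcv⟩ := exists_integral_ball_abs_inner_eq (E := E)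
  set μ : Measure E := volume.restrict (Metric.ball (0 : E) 1) with hμ
  have hid : Integrable (id : E → E) μ :=
    (continuous_id.continuousOn.integrableOn_compact
      (isCompact_closedBall (0 : E) 1)).mono_set Metric.ball_subset_closedBall
  -- Chosen so that `(c + η) / (c - η) = 1 + ε`.
  set η := c * ε / (2 + ε) with hη
  have hη0 : 0 < η := by positivity
  have hcη : c - η = 2 * c / (2 + ε) := by rw [hη]; field_simp; ring
  have hcη0 : 0 < c - η := by rw [hcη]; positivity
  -- Replacing the identity by a simple function turns `∫ |⟪x, v⟫| = c ‖v‖` into a finite sum, the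
  -- support function of a zonotope, with error at most `η ‖v‖`. Division by `c - η` makes the
  -- zonotope contain the unit ball.
  obtain ⟨f, hfi, hf⟩ : ∃ f : SimpleFunc E E, Integrable f μ ∧ ∫ x, ‖f x - x‖ ∂μ ≤ η := by
    have h1 := SimpleFunc.tendsto_approxOn_range_L1_enorm measurable_id hid
    obtain ⟨n, hn⟩ := (h1.eventually (gt_mem_nhds (ENNReal.ofReal_pos.2 hη0))).exists
    have hi := SimpleFunc.integrable_approxOn_range measurable_id hid n
    refine ⟨_, hi, ?_⟩
    have h2 : Integrable (fun x => SimpleFunc.approxOn id measurable_id (Set.range id ∪ {0}) 0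
      (by simp) n x - id x) μ := hi.sub hid
    have h3 := ofReal_integral_norm_eq_lintegral_enorm h2
    refine (ENNReal.ofReal_le_ofReal_iff hη0.le).1 ?_
    exact h3.trans_le hn.le
  have hsum : ∀ v : E, ∑ y ∈ f.range, μ.real (f ⁻¹' {y}) * |⟪y, v⟫| = ∫ x, |⟪f x, v⟫| ∂μ := by
    intro v
    have h1 := SimpleFunc.map_integral f (fun y => |⟪y, v⟫|) hfi (by simp)
    simp only [smul_eq_mul] at h1
    rw [← h1, SimpleFunc.integral_eq_integral]
    · rfl
    · have : Integrable (fun x => ⟪v, f x⟫) μ := hfi.const_inner v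
      refine this.abs.congr (Eventually.of_forall fun x => ?_)
      simp [real_inner_comm]
  have hclose : ∀ v : E, |∫ x, |⟪f x, v⟫| ∂μ - c * ‖v‖| ≤ η * ‖v‖ := by
    intro v
    have i1 : Integrable (fun x => |⟪f x, v⟫|) μ := by
      have : Integrable (fun x => ⟪v, f x⟫) μ := hfi.const_inner v
      refine this.abs.congr (Eventually.of_forall fun x => ?_)
      simp [real_inner_comm]
    have i2 : Integrable (fun x => |⟪x, v⟫|) μ := by
      have : Integrable (fun x => ⟪v, id x⟫) μ := hid.const_inner v
      refine this.abs.congr (Eventually.of_forall fun x => ?_)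
      simp [real_inner_comm]
    have i3 : Integrable (fun x => ‖f x - x‖) μ := (hfi.sub hid).norm
    rw [← hcv v, ← integral_sub i1 i2]
    refine (abs_integral_le_integral_abs).trans ?_
    calc ∫ x, |(|⟪f x, v⟫| - |⟪x, v⟫|)| ∂μ ≤ ∫ x, ‖f x - x‖ * ‖v‖ ∂μ := by
          refine integral_mono (i1.sub i2).abs (i3.mul_const _) fun x => ?_
          refine (abs_abs_sub_abs_le _ _).trans ?_
          rw [← inner_sub_left]
          exact abs_real_inner_le_norm _ _
      _ = (∫ x, ‖f x - x‖ ∂μ) * ‖v‖ := integral_mul_const _ _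
      _ ≤ η * ‖v‖ := by gcongr
  have hscale : ∀ v : E, ∑ y ∈ f.range, |⟪(μ.real (f ⁻¹' {y}) / (c - η)) • y, v⟫| =
      (∫ x, |⟪f x, v⟫| ∂μ) / (c - η) := by
    intro v
    rw [← hsum v, Finset.sum_div]
    refine Finset.sum_congr rfl fun y _ => ?_
    rw [real_inner_smul_left, abs_mul, abs_of_nonneg (div_nonneg measureReal_nonneg hcη0.le)]
    ring
  refine ⟨f.range, fun y => (μ.real (f ⁻¹' {y}) / (c - η)) • y, ?_, ?_⟩
  · refine closedBall_subset_zonotope _ _ fun v => ?_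
    rw [hscale, le_div_iff₀ hcη0]
    have := (abs_le.1 (hclose v)).1
    linarith
  · refine zonotope_subset_closedBall _ _ (by positivity) fun v => ?_
    rw [hscale, div_le_iff₀ hcη0]
    have := (abs_le.1 (hclose v)).2
    have h1 : (1 + ε) * (c - η) = c + η := by rw [hη]; field_simp; ring
    calc _ ≤ (c + η) * ‖v‖ := by linarith
      _ = _ := by rw [← h1]; ring

end Zonotope

/-! ### Volume of parallel bodies -/

section ParallelBody

variable {E : Type*} [NormedAddCommGroup E] [InnerProductSpace ℝ E]

theorem smul_zonotope {ι : Type*} (s : Finset ι) (u : ι → E) (h : ℝ) :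
    h • ∑ i ∈ s, segment ℝ (-u i) (u i) = ∑ i ∈ s, segment ℝ (h • -u i) (h • u i) := by
  classical
  induction s using Finset.induction_on with
  | empty => simp
  | insert i s hi ih =>
    rw [Finset.sum_insert hi, Finset.sum_insert hi, smul_add, ih]
    congr 1
    exact image_segment ℝ (LinearMap.lsmul ℝ E h).toAffineMap _ _

variable [FiniteDimensional ℝ E] [MeasurableSpace E] [BorelSpace E]

/-- Among the convex bodies in a ball of radius `R`, the ball itself gains most volume when it is
replaced by its parallel body. -/
theorem volume_real_add_closedBall_le {K : Set E} (hK : IsCompact K) (hKc : Convex ℝ K) {c : E}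
    {R h : ℝ} (hR : 0 ≤ R) (hh : 0 ≤ h) (hKR : K ⊆ Metric.closedBall c R) :
    volume.real (K + Metric.closedBall 0 h) ≤ volume.real K +
      volume.real (Metric.closedBall (0 : E) 1) *
        ((R + h) ^ Module.finrank ℝ E - R ^ Module.finrank ℝ E) := by
  have hball : ∀ r : ℝ, 0 ≤ r → volume.real (Metric.closedBall c r) =
      volume.real (Metric.closedBall (0 : E) 1) * r ^ Module.finrank ℝ E := fun r hr => by
    rw [Measure.addHaar_real_closedBall' _ _ hr, mul_comm]
  -- With `Z` a zonotope between `𝔹` and `(1 + ε)𝔹`, the gain of `K` from `h𝔹` is at most its gain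
  -- from `hZ`, hence at most that of the large ball from `hZ`, hence from `h (1 + ε)𝔹`.
  have key : ∀ ε : ℝ, 0 < ε → volume.real (K + Metric.closedBall 0 h) ≤ volume.real K +
      volume.real (Metric.closedBall (0 : E) 1) *
        ((R + h * (1 + ε)) ^ Module.finrank ℝ E - R ^ Module.finrank ℝ E) := by
    intro ε hε
    obtain ⟨s, u, h1, h2⟩ := exists_zonotope_approx_closedBall (E := E) hε
    have hQ := isCompact_closedBall c R
    have hZ := isCompact_zonotope s (fun i => h • -u i) (fun i => h • u i)
    have h3 := volume_add_zonotope_le s (fun i => h • -u i) (fun i => h • u i) hK hQ hKc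
      (convex_closedBall c R) hKR
    have h4 : volume.real (K + ∑ i ∈ s, segment ℝ (h • -u i) (h • u i)) +
        volume.real (Metric.closedBall c R) ≤
        volume.real (Metric.closedBall c R + ∑ i ∈ s, segment ℝ (h • -u i) (h • u i)) +
        volume.real K := by
      have := ENNReal.toReal_mono (ENNReal.add_ne_top.2
        ⟨(hQ.add hZ).measure_lt_top.ne, hK.measure_lt_top.ne⟩) h3
      rwa [ENNReal.toReal_add (hK.add hZ).measure_lt_top.ne hQ.measure_lt_top.ne,
        ENNReal.toReal_add (hQ.add hZ).measure_lt_top.ne hK.measure_lt_top.ne] at this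
    rw [← smul_zonotope] at h4 hZ
    have h5 : Metric.closedBall 0 h ⊆ h • ∑ i ∈ s, segment ℝ (-u i) (u i) := by
      have := Set.smul_set_mono (a := h) h1
      rwa [smul_unitClosedBall_of_nonneg hh] at this
    have h6 : h • ∑ i ∈ s, segment ℝ (-u i) (u i) ⊆ Metric.closedBall 0 (h * (1 + ε)) := by
      refine (Set.smul_set_mono (a := h) h2).trans ?_
      rw [smul_closedBall _ _ (by positivity), smul_zero, Real.norm_of_nonneg hh]
    have h7 : volume.real (K + Metric.closedBall 0 h) ≤
        volume.real (K + h • ∑ i ∈ s, segment ℝ (-u i) (u i)) :=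
      measureReal_mono (Set.add_subset_add_left h5) (hK.add hZ).measure_lt_top.ne
    have h8 : volume.real (Metric.closedBall c R + h • ∑ i ∈ s, segment ℝ (-u i) (u i)) ≤
        volume.real (Metric.closedBall c (R + h * (1 + ε))) := by
      refine measureReal_mono ((Set.add_subset_add_left h6).trans ?_)
        (isCompact_closedBall _ _).measure_lt_top.ne
      rw [closedBall_add_closedBall hR (by positivity), add_zero]
    rw [hball R hR] at h4
    rw [hball _ (by positivity)] at h8
    linarith
  have hlim : Tendsto (fun ε : ℝ => volume.real K +
      volume.real (Metric.closedBall (0 : E) 1) *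
        ((R + h * (1 + ε)) ^ Module.finrank ℝ E - R ^ Module.finrank ℝ E)) (𝓝[>] 0)
      (𝓝 (volume.real K + volume.real (Metric.closedBall (0 : E) 1) *
        ((R + h * (1 + 0)) ^ Module.finrank ℝ E - R ^ Module.finrank ℝ E))) :=
    ((by fun_prop : Continuous fun ε : ℝ => volume.real K +
      volume.real (Metric.closedBall (0 : E) 1) *
        ((R + h * (1 + ε)) ^ Module.finrank ℝ E - R ^ Module.finrank ℝ E)).tendsto 0).mono_left
      nhdsWithin_le_nhds
  rw [add_zero, mul_one] at hlim
  exact ge_of_tendsto hlim (eventually_mem_nhdsWithin.mono fun ε hε => key ε hε)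

end ParallelBody

/-- In the induction step the second-order term `2 (k + 1) R ^ k h²` is absorbed into `R ^ (k + 1)
h` by the smallness of `h`. The resulting factor 2 is the one in `volLip`. -/
theorem add_pow_succ_le {R h : ℝ} (hR : 0 ≤ R) (hh : 0 ≤ h) (k : ℕ) (hk : 2 * (k : ℝ) * h ≤ R) :
    (R + h) ^ (k + 1) ≤ R ^ (k + 1) + 2 * ((k : ℝ) + 1) * R ^ k * h := by
  induction k with
  | zero => simp; linarith
  | succ k ih =>
    push_cast at hk ⊢
    have h1 := ih (by nlinarith)
    have h2 : 0 ≤ R ^ k * h := by positivity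
    have h3 := mul_le_mul_of_nonneg_right h1 (add_nonneg hR hh)
    have h4 := mul_le_mul_of_nonneg_left hk h2
    calc (R + h) ^ (k + 1 + 1) = (R + h) ^ (k + 1) * (R + h) := pow_succ _ _
      _ ≤ (R ^ (k + 1) + 2 * ((k : ℝ) + 1) * R ^ k * h) * (R + h) := h3
      _ = R ^ (k + 1 + 1) + (2 * (k : ℝ) + 3) * (R ^ (k + 1) * h) +
          R ^ k * h * (2 * ((k : ℝ) + 1) * h) := by ring
      _ ≤ R ^ (k + 1 + 1) + (2 * (k : ℝ) + 3) * (R ^ (k + 1) * h) + R ^ k * h * R := by gcongr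
      _ = _ := by ring

/-! ### Volume of the difference of two convex bodies -/

section Bodies

variable {m : ℕ} {Y A B : Set (EuclideanSpace ℝ (Fin m))}

theorem volLip_nonneg : 0 ≤ volLip m Y := by
  unfold volLip
  have : 0 ≤ Metric.diam Y := Metric.diam_nonneg
  positivity

/-- The volume of the difference of two convex bodies is controlled by their Hausdorff
distance. -/
theorem volume_real_diff_le (hY : IsCompact Y) (hAY : A ⊆ Y) (hBY : B ⊆ Y) (hA : IsCompact A)
    (hB : IsCompact B) (hBc : Convex ℝ B) (hAne : A.Nonempty) (hBne : B.Nonempty) :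
    volume.real (A \ B) ≤ volLip m Y * Metric.hausdorffDist A B := by
  -- For `m = 0` the space is a single point, so `A \ B` is empty.
  rcases m with _ | k
  · have : A \ B = ∅ := by
      obtain ⟨b, hb⟩ := hBne
      exact Set.sdiff_eq_empty.2 fun a _ => by rwa [Subsingleton.elim a b]
    rw [this, measureReal_empty]
    exact mul_nonneg volLip_nonneg Metric.hausdorffDist_nonneg
  obtain ⟨c, hc⟩ := exists_subset_closedBall_jung hY.isBounded
  rw [finrank_euclideanSpace_fin] at hc
  set h := Metric.hausdorffDist A B with hh
  have hh0 : 0 ≤ h := Metric.hausdorffDist_nonneg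
  have hvol : volLip (k + 1) Y = 2 * ((k : ℝ) + 1) *
      volume.real (Metric.closedBall (0 : EuclideanSpace ℝ (Fin (k + 1))) 1) *
      (Metric.diam Y * Real.sqrt (((k + 1 : ℕ) : ℝ) / (2 * (((k + 1 : ℕ) : ℝ) + 1)))) ^ k := by
    simp [volLip, measureReal_def]
  set R := Metric.diam Y * Real.sqrt (((k + 1 : ℕ) : ℝ) / (2 * (((k + 1 : ℕ) : ℝ) + 1)))
    with hRdef
  have hR : 0 ≤ R := mul_nonneg Metric.diam_nonneg (Real.sqrt_nonneg _)
  set ω := volume.real (Metric.closedBall (0 : EuclideanSpace ℝ (Fin (k + 1))) 1) with hω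
  have hω0 : 0 ≤ ω := measureReal_nonneg
  rw [hvol]
  -- For small `h` the parallel body of `B` is used; for large `h` the Jung ball, of volume `ω R ^
  -- (k + 1)`, already suffices.
  rcases le_total (2 * ((k : ℝ) + 1) * h) R with hle | hle
  · have h1 := volume_real_add_closedBall_le hB hBc hR hh0 (hBY.trans hc)
    rw [finrank_euclideanSpace_fin] at h1
    have hBb := hB.add (isCompact_closedBall (0 : EuclideanSpace ℝ (Fin (k + 1))) h)
    have h2 : A \ B ⊆ (B + Metric.closedBall 0 h) \ B := by
      refine Set.sdiff_subset_sdiff_left fun a ha => ?_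
      obtain ⟨b, hb, hab⟩ := hB.exists_infDist_eq_dist hBne a
      refine Set.mem_add.2 ⟨b, hb, a - b, ?_, by simp⟩
      rw [mem_closedBall_zero_iff, ← dist_eq_norm, ← hab]
      exact Metric.infDist_le_hausdorffDist_of_mem ha
        (Metric.hausdorffEDist_ne_top_of_nonempty_of_bounded hAne hBne hA.isBounded hB.isBounded)
    have h3 : volume.real (A \ B) ≤ volume.real ((B + Metric.closedBall 0 h) \ B) :=
      measureReal_mono h2 (measure_ne_top_of_subset Set.sdiff_subset hBb.measure_lt_top.ne)
    have h4 : B ⊆ B + Metric.closedBall 0 h :=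
      Set.subset_add_left B (by simpa using hh0)
    rw [measureReal_sdiff h4 hB.measurableSet hBb.measure_lt_top.ne] at h3
    have h5 := add_pow_succ_le hR hh0 k (by nlinarith)
    calc volume.real (A \ B) ≤ ω * ((R + h) ^ (k + 1) - R ^ (k + 1)) := by linarith
      _ ≤ ω * (2 * ((k : ℝ) + 1) * R ^ k * h) := by gcongr; linarith
      _ = _ := by ring
  · calc volume.real (A \ B) ≤ volume.real (Metric.closedBall c R) :=
          measureReal_mono (Set.sdiff_subset.trans (hAY.trans hc))
            (isCompact_closedBall _ _).measure_lt_top.ne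
      _ = R ^ (k + 1) * ω := by
          rw [Measure.addHaar_real_closedBall' _ _ hR, finrank_euclideanSpace_fin]
      _ = ω * R ^ k * R := by ring
      _ ≤ ω * R ^ k * (2 * ((k : ℝ) + 1) * h) := by gcongr
      _ = _ := by ring

end Bodies

/-! ### Total variation and averages over sets -/

section TotalVariation

variable {Ω : Type*} [MeasurableSpace Ω]

theorem abs_setIntegral_le (ρ : Measure Ω) {s : Set Ω} (hs : ρ s ≠ ∞) {f : Ω → ℝ}
    (hf : ∀ y, |f y| ≤ 1) : |∫ y in s, f y ∂ρ| ≤ ρ.real s := by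
  simpa using norm_setIntegral_le_of_norm_le_const (μ := ρ) hs.lt_top (C := 1) (f := f)
    (fun y _ => hf y)

/-- The averages of a bounded function over two sets. -/
theorem abs_average_sub_average_le (ρ : Measure Ω) {A B : Set Ω} (hA : MeasurableSet A)
    (hB : MeasurableSet B) (hAf : ρ A ≠ ∞) (hBf : ρ B ≠ ∞) (hB0 : 0 < ρ.real B)
    (hBA : ρ.real B ≤ ρ.real A) {f : Ω → ℝ} (hfm : Measurable f) (hf : ∀ y, |f y| ≤ 1) :
    |(ρ.real A)⁻¹ * ∫ y in A, f y ∂ρ - (ρ.real B)⁻¹ * ∫ y in B, f y ∂ρ| ≤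
      2 * ρ.real (A \ B) / ρ.real A := by
  have hA0 : 0 < ρ.real A := hB0.trans_le hBA
  have hfint : ∀ s : Set Ω, ρ s ≠ ∞ → IntegrableOn f s ρ := fun s hs =>
    Measure.integrableOn_of_bounded hs hfm.aestronglyMeasurable
      (Eventually.of_forall fun y => hf y)
  have e1 := integral_inter_add_sdiff hB (hfint A hAf)
  have e2 := integral_inter_add_sdiff hA (hfint B hBf)
  have m1 := measureReal_inter_add_sdiff (μ := ρ) (s := A) hB hAf
  have m2 := measureReal_inter_add_sdiff (μ := ρ) (s := B) hA hBf
  rw [Set.inter_comm] at e2 m2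
  have b1 := abs_setIntegral_le ρ (measure_ne_top_of_subset Set.inter_subset_left hAf) hf
    (s := A ∩ B)
  have b2 := abs_setIntegral_le ρ (measure_ne_top_of_subset Set.sdiff_subset hAf) hf
    (s := A \ B)
  have b3 := abs_setIntegral_le ρ (measure_ne_top_of_subset Set.sdiff_subset hBf) hf
    (s := B \ A)
  rw [← e1, ← e2]
  set I := ∫ y in A ∩ B, f y ∂ρ
  set J := ∫ y in A \ B, f y ∂ρ
  set K := ∫ y in B \ A, f y ∂ρ
  set a := ρ.real A
  set b := ρ.real B
  have hinv : a⁻¹ ≤ b⁻¹ := inv_anti₀ hB0 hBA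
  have ha' : 0 < a⁻¹ := inv_pos.2 hA0
  have hb' : 0 < b⁻¹ := inv_pos.2 hB0
  -- Bounding the three integrals by the measures of their domains loses nothing in total: with `d =
  -- ρ(A \ B)` the terms add up to exactly `2 d / a`, with the larger measure `a` as denominator.
  calc |a⁻¹ * (I + J) - b⁻¹ * (I + K)| = |a⁻¹ * J - (b⁻¹ - a⁻¹) * I - b⁻¹ * K| := by
        congr 1; ring
    _ ≤ |a⁻¹ * J| + |(b⁻¹ - a⁻¹) * I| + |b⁻¹ * K| := by
        exact (abs_sub _ _).trans (add_le_add_left (abs_sub _ _) _)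
    _ = a⁻¹ * |J| + (b⁻¹ - a⁻¹) * |I| + b⁻¹ * |K| := by
        rw [abs_mul, abs_mul, abs_mul, abs_of_pos ha', abs_of_pos hb',
          abs_of_nonneg (sub_nonneg.2 hinv)]
    _ ≤ a⁻¹ * ρ.real (A \ B) + (b⁻¹ - a⁻¹) * ρ.real (A ∩ B) + b⁻¹ * ρ.real (B \ A) := by
        have := sub_nonneg.2 hinv
        gcongr
    _ = 2 * ρ.real (A \ B) / a := by
        have h1 : ρ.real (A ∩ B) = a - ρ.real (A \ B) := by linarith
        have h2 : ρ.real (B \ A) = b - (a - ρ.real (A \ B)) := by linarith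
        rw [h1, h2]
        field_simp
        ring

theorem tvDist_nonneg (μ ν : ProbabilityMeasure Ω) : 0 ≤ tvDist μ ν := by
  -- The value 0 comes from the test function 0; the bound 2 makes the real supremum a genuine one.
  refine le_csSup ⟨2, ?_⟩ ⟨0, measurable_const, by simp, by simp⟩
  rintro r ⟨f, -, hf, rfl⟩
  have h : ∀ κ : ProbabilityMeasure Ω, |∫ y, f y ∂(κ : Measure Ω)| ≤ 1 := fun κ => by
    simpa using abs_setIntegral_le (κ : Measure Ω) (s := Set.univ) (measure_ne_top _ _) hf
  linarith [(abs_le.1 (h μ)).2, (abs_le.1 (h ν)).1]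

theorem tvDist_le {μ ν : ProbabilityMeasure Ω} {C : ℝ}
    (h : ∀ f : Ω → ℝ, Measurable f → (∀ y, |f y| ≤ 1) →
      ∫ y, f y ∂(μ : Measure Ω) - ∫ y, f y ∂(ν : Measure Ω) ≤ C) : tvDist μ ν ≤ C := by
  refine csSup_le ⟨_, 0, measurable_const, by simp, rfl⟩ ?_
  rintro r ⟨f, hfm, hf, rfl⟩
  exact h f hfm hf

end TotalVariation

/-! ### Total variation estimate for neutral beliefs -/

section Belief

variable {X : Type*} {m : ℕ} {Y : Set (EuclideanSpace ℝ (Fin m))}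
  {S : X → Set (EuclideanSpace ℝ (Fin m))}

theorem integral_uniformMeasure (hY : IsCompact Y) (C : Set (EuclideanSpace ℝ (Fin m)))
    (f : Y → ℝ) :
    ∫ y, f y ∂(uniformMeasure Y C) = (volume.real C)⁻¹ *
      ∫ y in ((↑) : Y → EuclideanSpace ℝ (Fin m)) ⁻¹' C, f y
        ∂(Measure.comap ((↑) : Y → EuclideanSpace ℝ (Fin m)) volume) := by
  rw [uniformMeasure, integral_smul_measure,
    (MeasurableEmbedding.subtype_coe hY.measurableSet).comap_restrict, ENNReal.toReal_inv,
    smul_eq_mul, measureReal_def]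

theorem comap_coe_preimage (hY : IsCompact Y) {C : Set (EuclideanSpace ℝ (Fin m))} (hC : C ⊆ Y) :
    Measure.comap ((↑) : Y → EuclideanSpace ℝ (Fin m)) volume
      (((↑) : Y → EuclideanSpace ℝ (Fin m)) ⁻¹' C) = volume C := by
  rw [comap_subtype_coe_apply hY.measurableSet, Subtype.image_preimage_coe,
    Set.inter_eq_right.2 hC]

theorem HasConvexBodyValues.volume_real_pos (hS : HasConvexBodyValues Y S) (x : X) :
    0 < volume.real (S x) :=
  ENNReal.toReal_pos
    (Measure.measure_pos_of_nonempty_interior _ (hS.nonempty_interior x)).ne'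
    (hS.isCompact x).measure_lt_top.ne

theorem HasConvexBodyValues.volume_real_diff_le (hY : IsCompact Y)
    (hS : HasConvexBodyValues Y S) (x x' : X) :
    volume.real (S x \ S x') ≤ volLip m Y * Metric.hausdorffDist (S x) (S x') :=
  NeutralBelief.volume_real_diff_le hY (hS.subset x) (hS.subset x') (hS.isCompact x)
    (hS.isCompact x') (hS.convex x') ((hS.nonempty_interior x).mono interior_subset)
    ((hS.nonempty_interior x').mono interior_subset)

theorem HasConvexBodyValues.abs_integral_sub_integral_le (hY : IsCompact Y)
    (hS : HasConvexBodyValues Y S) {x x' : X} (hle : volume.real (S x') ≤ volume.real (S x))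
    {f : Y → ℝ} (hfm : Measurable f) (hf : ∀ y, |f y| ≤ 1) :
    |∫ y, f y ∂(uniformMeasure Y (S x)) - ∫ y, f y ∂(uniformMeasure Y (S x'))| ≤
      2 * volLip m Y / volume.real (S x) * Metric.hausdorffDist (S x) (S x') := by
  set ρ := Measure.comap ((↑) : Y → EuclideanSpace ℝ (Fin m)) volume
  set P : X → Set Y := fun z => ((↑) : Y → EuclideanSpace ℝ (Fin m)) ⁻¹' (S z)
  have hρ : ∀ z, ρ (P z) = volume (S z) := fun z => comap_coe_preimage hY (hS.subset z)
  have hρr : ∀ z, ρ.real (P z) = volume.real (S z) := fun z => congrArg ENNReal.toReal (hρ z)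
  have hfin : ∀ z, ρ (P z) ≠ ∞ := fun z => (hρ z).trans_ne (hS.isCompact z).measure_lt_top.ne
  have hmeas : ∀ z, MeasurableSet (P z) := fun z =>
    measurable_subtype_coe (hS.isCompact z).measurableSet
  have hdiff : ρ.real (P x \ P x') = volume.real (S x \ S x') :=
    congrArg ENNReal.toReal
      (comap_coe_preimage hY (Set.sdiff_subset.trans (hS.subset x) : S x \ S x' ⊆ Y))
  have h := abs_average_sub_average_le ρ (hmeas x) (hmeas x') (hfin x) (hfin x')
    (by rw [hρr]; exact hS.volume_real_pos x') (by rw [hρr, hρr]; exact hle) hfm hf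
  rw [hdiff, hρr, hρr] at h
  rw [integral_uniformMeasure hY, integral_uniformMeasure hY]
  refine h.trans ?_
  have h0 := hS.volume_real_pos x
  rw [div_mul_eq_mul_div, mul_assoc]
  gcongr
  exact hS.volume_real_diff_le hY x x'

/-- Since the larger volume is the denominator, a lower bound `v` on just one of the two volumes is
enough. The three parts of the main theorem differ only in the choice of `v`. -/
theorem tvDist_neutralBelief_le (hY : IsCompact Y) (hS : HasConvexBodyValues Y S) {x x' : X}
    {v : ℝ} (hv : 0 < v) (hvmax : v ≤ max (volume.real (S x)) (volume.real (S x'))) :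
    tvDist (neutralBelief hY hS x) (neutralBelief hY hS x') ≤
      2 * volLip m Y / v * Metric.hausdorffDist (S x) (S x') := by
  refine tvDist_le fun f hfm hf => ?_
  have hL : 0 ≤ 2 * volLip m Y := mul_nonneg zero_le_two volLip_nonneg
  have hd : 0 ≤ Metric.hausdorffDist (S x) (S x') := Metric.hausdorffDist_nonneg
  change ∫ y, f y ∂(uniformMeasure Y (S x)) - ∫ y, f y ∂(uniformMeasure Y (S x')) ≤ _
  rcases le_total (volume.real (S x')) (volume.real (S x)) with hle | hle
  · rw [max_eq_left hle] at hvmax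
    refine ((le_abs_self _).trans (hS.abs_integral_sub_integral_le hY hle hfm hf)).trans ?_
    gcongr
  · rw [max_eq_right hle] at hvmax
    have h1 := (neg_abs_le _).trans' (neg_le_neg (hS.abs_integral_sub_integral_le hY hle hfm hf))
    rw [Metric.hausdorffDist_comm] at h1
    have h2 : 2 * volLip m Y / volume.real (S x') * Metric.hausdorffDist (S x) (S x') ≤
        2 * volLip m Y / v * Metric.hausdorffDist (S x) (S x') := by gcongr
    linarith

end Belief

/-! ### Comparison of Lipschitz numbers -/

section LipschitzNumbers

variable {M N N' : Type*} [MetricSpace M] {d : N → N → ℝ} {d' : N' → N' → ℝ} {f : M → N}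
  {g : M → N'} {A : Set M}

theorem IsLipOn.lipOn_ne_top (h : IsLipOn d f A) : lipOn d f A ≠ ∞ := by
  obtain ⟨L, hL⟩ := h
  exact ((iInf₂_le L hL).trans_lt ENNReal.ofReal_lt_top).ne

theorem IsLipOn.mono {B : Set M} (h : IsLipOn d f A) (hBA : B ⊆ A) : IsLipOn d f B := by
  obtain ⟨L, hL, h⟩ := h
  exact ⟨L, hL, fun x hx x' hx' => h x (hBA hx) x' (hBA hx')⟩

theorem lipOn_mono {B : Set M} (hBA : B ⊆ A) : lipOn d f B ≤ lipOn d f A :=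
  le_iInf₂ fun L hL => iInf₂_le L ⟨hL.1, fun x hx x' hx' => hL.2 x (hBA hx) x' (hBA hx')⟩

theorem IsLipOn.of_le_mul {c : ℝ} (hc : 0 ≤ c)
    (h : ∀ x ∈ A, ∀ x' ∈ A, d' (g x) (g x') ≤ c * d (f x) (f x')) (hf : IsLipOn d f A) :
    IsLipOn d' g A := by
  obtain ⟨L, hL, hfL⟩ := hf
  -- The summand 1 keeps the constant positive when `c = 0`.
  refine ⟨c * L + 1, by positivity, fun x hx x' hx' => (h x hx x' hx').trans ?_⟩
  calc c * d (f x) (f x') ≤ c * (L * dist x x') := by gcongr; exact hfL x hx x' hx'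
    _ ≤ c * (L * dist x x') + dist x x' := le_add_of_nonneg_right dist_nonneg
    _ = _ := by ring

theorem lipOn_le_mul {c : ℝ} (hc : 0 ≤ c)
    (h : ∀ x ∈ A, ∀ x' ∈ A, d' (g x) (g x') ≤ c * d (f x) (f x')) :
    lipOn d' g A ≤ ENNReal.ofReal c * lipOn d f A := by
  -- Lipschitz constants are positive, so for `c = 0` the infimum 0 is only approached, through
  -- arbitrary `ε > 0`.
  rcases eq_or_lt_of_le hc with rfl | hc
  · rw [ENNReal.ofReal_zero, zero_mul]
    refine le_of_forall_pos_le_add fun ε hε => ?_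
    rw [zero_add]
    rcases eq_or_ne ε ∞ with rfl | hε'
    · exact le_top
    have hpos := ENNReal.toReal_pos hε.ne' hε'
    refine (iInf₂_le ε.toReal ⟨hpos, fun x hx x' hx' => ?_⟩).trans
      (ENNReal.ofReal_toReal hε').le
    exact (h x hx x' hx').trans (by rw [zero_mul]; positivity)
  · have h0 : ENNReal.ofReal c ≠ 0 := (ENNReal.ofReal_pos.2 hc).ne'
    simp_rw [lipOn, ENNReal.mul_iInf_of_ne h0 ENNReal.ofReal_ne_top]
    refine le_iInf₂ fun L hL => ?_
    rw [← ENNReal.ofReal_mul hc.le]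
    refine iInf₂_le (c * L) ⟨mul_pos hc hL.1, fun x hx x' hx' => (h x hx x' hx').trans ?_⟩
    rw [mul_assoc]
    have hxx := hL.2 x hx x' hx'
    exact mul_le_mul_of_nonneg_left hxx hc.le

/-- A bound for `Lip(g, x)` from bounds on small balls whose constants tend to `c`. -/
theorem lipAt_le_mul {c : ℝ → ℝ} {v : ℝ} {x : M} (hc : ContinuousAt c v)
    (hf : IsLipOn d f Set.univ)
    (h : ∀ᶠ w in 𝓝[<] v, 0 ≤ c w ∧ ∃ δ : ℝ, 0 < δ ∧ ∀ y ∈ Metric.ball x δ,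
      ∀ y' ∈ Metric.ball x δ, d' (g y) (g y') ≤ c w * d (f y) (f y')) :
    lipAt d' g x ≤ ENNReal.ofReal (c v) * lipAt d f x := by
  -- For fixed `δ` let `w` increase to `v`; the limit passes through the product because the
  -- Lipschitz number of `f` on the ball is finite.
  have key : ∀ δ : ℝ, 0 < δ →
      lipAt d' g x ≤ ENNReal.ofReal (c v) * lipOn d f (Metric.ball x δ) := by
    intro δ hδ
    have hfin := (hf.mono (Set.subset_univ (Metric.ball x δ))).lipOn_ne_top
    have hlim : Tendsto (fun w => ENNReal.ofReal (c w) * lipOn d f (Metric.ball x δ)) (𝓝[<] v)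
        (𝓝 (ENNReal.ofReal (c v) * lipOn d f (Metric.ball x δ))) :=
      ENNReal.Tendsto.mul_const
        ((ENNReal.continuous_ofReal.tendsto _).comp (hc.tendsto.mono_left nhdsWithin_le_nhds))
        (Or.inr hfin)
    refine ge_of_tendsto hlim (h.mono fun w hw => ?_)
    obtain ⟨hcw, δ', hδ', hw⟩ := hw
    have h1 : Metric.ball x (min δ δ') ⊆ Metric.ball x δ' :=
      Metric.ball_subset_ball (min_le_right _ _)
    calc lipAt d' g x ≤ lipOn d' g (Metric.ball x (min δ δ')) :=
          iInf₂_le (min δ δ') (lt_min hδ hδ')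
      _ ≤ ENNReal.ofReal (c w) * lipOn d f (Metric.ball x (min δ δ')) :=
          lipOn_le_mul hcw fun y hy y' hy' => hw y (h1 hy) y' (h1 hy')
      _ ≤ _ := by
          gcongr
          exact lipOn_mono (Metric.ball_subset_ball (min_le_left _ _))
  -- A nonzero finite factor commutes with the infimum over `δ`; for the factor 0 a single `δ`
  -- suffices.
  rcases eq_or_ne (ENNReal.ofReal (c v)) 0 with h0 | h0
  · have := key 1 one_pos
    rw [h0, zero_mul] at this ⊢
    exact this
  · simp_rw [lipAt, ENNReal.mul_iInf_of_ne h0 ENNReal.ofReal_ne_top]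
    exact le_iInf₂ key

theorem IsLipOn.isContinuousWrt (hd : ∀ a b, 0 ≤ d a b) (hf : IsLipOn d f Set.univ) :
    IsContinuousWrt d f := by
  obtain ⟨L, -, hL⟩ := hf
  intro x
  have h1 : Tendsto (fun y => L * dist y x) (𝓝 x) (𝓝 0) := by
    simpa using ((by fun_prop : Continuous fun y => L * dist y x).tendsto x)
  exact squeeze_zero (fun y => hd _ _) (fun y => hL y trivial x trivial) h1

end LipschitzNumbers

/-! ### Continuity of the volume and the main theorem -/

section Main

variable {X : Type*} [MetricSpace X] {m : ℕ} {Y : Set (EuclideanSpace ℝ (Fin m))}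
  {S : X → Set (EuclideanSpace ℝ (Fin m))}

/-- The difference `λ(S y) - λ(S z)` is at most `λ(S y \ S z)`, so the volume is Lipschitz in the
Hausdorff distance. -/
theorem HasConvexBodyValues.continuous_volume_real (hY : IsCompact Y)
    (hS : HasConvexBodyValues Y S) (hc : IsContinuousWrt Metric.hausdorffDist S) :
    Continuous fun x => volume.real (S x) := by
  refine continuous_iff_continuousAt.2 fun x => ?_
  have hle : ∀ y z, volume.real (S y) - volume.real (S z) ≤
      volLip m Y * Metric.hausdorffDist (S y) (S z) := by
    intro y z
    have h1 := measureReal_inter_add_sdiff (μ := volume) (s := S y) (hS.isCompact z).measurableSet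
      (hS.isCompact y).measure_lt_top.ne
    have h2 : volume.real (S y ∩ S z) ≤ volume.real (S z) :=
      measureReal_mono Set.inter_subset_right (hS.isCompact z).measure_lt_top.ne
    linarith [hS.volume_real_diff_le hY y z]
  refine tendsto_iff_dist_tendsto_zero.2 (squeeze_zero (fun _ => dist_nonneg) (fun y => ?_)
    (by simpa using (hc x).const_mul (volLip m Y)))
  rw [Real.dist_eq, abs_sub_le_iff]
  refine ⟨hle y x, ?_⟩
  rw [Metric.hausdorffDist_comm]
  exact hle x y

theorem isContinuousWrt_neutralBelief (hY : IsCompact Y) (hS : HasConvexBodyValues Y S)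
    (hc : IsContinuousWrt Metric.hausdorffDist S) :
    IsContinuousWrt tvDist (neutralBelief hY hS) := by
  intro x
  refine squeeze_zero (fun _ => tvDist_nonneg _ _)
    (fun y => tvDist_neutralBelief_le hY hS (hS.volume_real_pos x) (le_max_right _ _)) ?_
  simpa using (hc x).const_mul (2 * volLip m Y / volume.real (S x))

/-- Near `x`, the volume `λ(S(x))` in the Lipschitz estimate may be replaced by any smaller
number. -/
theorem exists_ball_tvDist_neutralBelief_le (hY : IsCompact Y) (hS : HasConvexBodyValues Y S)
    (hc : IsContinuousWrt Metric.hausdorffDist S) {x : X} {w : ℝ} (hw : 0 < w)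
    (hwx : w < volume.real (S x)) :
    ∃ δ : ℝ, 0 < δ ∧ ∀ y ∈ Metric.ball x δ, ∀ y' ∈ Metric.ball x δ,
      tvDist (neutralBelief hY hS y) (neutralBelief hY hS y') ≤
        2 * volLip m Y / w * Metric.hausdorffDist (S y) (S y') := by
  obtain ⟨δ, hδ, h⟩ := Metric.eventually_nhds_iff_ball.1
    ((hS.continuous_volume_real hY hc).continuousAt.eventually (lt_mem_nhds hwx))
  exact ⟨δ, hδ, fun y hy y' _ =>
    tvDist_neutralBelief_le hY hS hw ((h y hy).le.trans (le_max_left _ _))⟩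

theorem ofReal_two_mul_volLip_div {v : ℝ} (hv : 0 < v) :
    ENNReal.ofReal (2 * volLip m Y / v) =
      2 * ENNReal.ofReal (volLip m Y) / ENNReal.ofReal v := by
  rw [ENNReal.ofReal_div_of_pos hv, ENNReal.ofReal_mul zero_le_two, ENNReal.ofReal_ofNat]

end Main

end NeutralBelief

theorem mainTheorem1 {X : Type*} [MetricSpace X] {m : ℕ}
    {Y : Set (EuclideanSpace ℝ (Fin m))} (hY : IsCompact Y) (_hYne : Y.Nonempty)
    {S : X → Set (EuclideanSpace ℝ (Fin m))} (hS : NeutralBelief.HasConvexBodyValues Y S) :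
    (NeutralBelief.IsContinuousWrt Metric.hausdorffDist S →
      NeutralBelief.IsContinuousWrt NeutralBelief.tvDist (NeutralBelief.neutralBelief hY hS)) ∧
    (NeutralBelief.IsLipOn Metric.hausdorffDist S Set.univ →
      NeutralBelief.IsLocallyLip NeutralBelief.tvDist (NeutralBelief.neutralBelief hY hS) ∧
      (∀ x : X,
        NeutralBelief.lipAt NeutralBelief.tvDist (NeutralBelief.neutralBelief hY hS) x ≤
          2 * ENNReal.ofReal (NeutralBelief.volLip m Y) / volume (S x) *
            NeutralBelief.lipAt Metric.hausdorffDist S x) ∧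
      (CompactSpace X →
        NeutralBelief.IsLipOn NeutralBelief.tvDist (NeutralBelief.neutralBelief hY hS) Set.univ ∧
        (Nonempty X → ∃ v : ENNReal, IsLeast (Set.range fun x : X => volume (S x)) v ∧
          NeutralBelief.lipOn NeutralBelief.tvDist (NeutralBelief.neutralBelief hY hS) Set.univ ≤
            2 * ENNReal.ofReal (NeutralBelief.volLip m Y) *
              NeutralBelief.lipOn Metric.hausdorffDist S Set.univ / v))) := by
  refine ⟨NeutralBelief.isContinuousWrt_neutralBelief hY hS, fun hLip => ?_⟩
  have hc : NeutralBelief.IsContinuousWrt Metric.hausdorffDist S :=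
    hLip.isContinuousWrt fun _ _ => Metric.hausdorffDist_nonneg
  have hpos := hS.volume_real_pos
  have hvol : ∀ x, ENNReal.ofReal (volume.real (S x)) = volume (S x) := fun x =>
    ENNReal.ofReal_toReal (hS.isCompact x).measure_lt_top.ne
  have hL : 0 ≤ 2 * NeutralBelief.volLip m Y := mul_nonneg zero_le_two NeutralBelief.volLip_nonneg
  refine ⟨fun x => ?_, fun x => ?_, fun hX => ?_⟩
  -- Any positive number below `λ(S x)` would serve for local Lipschitz continuity; half of it is
  -- taken.
  · obtain ⟨δ, hδ, h⟩ := NeutralBelief.exists_ball_tvDist_neutralBelief_le hY hS hc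
      (half_pos (hpos x)) (half_lt_self (hpos x))
    exact ⟨δ, hδ, (hLip.mono (Set.subset_univ _)).of_le_mul
      (div_nonneg hL (half_pos (hpos x)).le) h⟩
  · rw [← hvol x, ← NeutralBelief.ofReal_two_mul_volLip_div (hpos x)]
    refine NeutralBelief.lipAt_le_mul (c := fun w => 2 * NeutralBelief.volLip m Y / w)
      (continuousAt_const.div continuousAt_id (hpos x).ne') hLip ?_
    filter_upwards [Ioo_mem_nhdsLT (hpos x)] with w hw
    exact ⟨div_nonneg hL hw.1.le,
      NeutralBelief.exists_ball_tvDist_neutralBelief_le hY hS hc hw.1 hw.2⟩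
  · rcases isEmpty_or_nonempty X with hXe | hXne
    -- On the empty space every positive number is a Lipschitz constant.
    · exact ⟨⟨1, one_pos, fun x => isEmptyElim x⟩, fun h => h.elim isEmptyElim⟩
    obtain ⟨x₀, -, hmin⟩ := isCompact_univ.exists_isMinOn Set.univ_nonempty
      (hS.continuous_volume_real hY hc).continuousOn
    have hmin' : ∀ x, volume.real (S x₀) ≤ volume.real (S x) := fun x => hmin (Set.mem_univ x)
    have hbound : ∀ x ∈ Set.univ, ∀ x' ∈ Set.univ,
        NeutralBelief.tvDist (NeutralBelief.neutralBelief hY hS x)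
          (NeutralBelief.neutralBelief hY hS x') ≤
        2 * NeutralBelief.volLip m Y / volume.real (S x₀) *
          Metric.hausdorffDist (S x) (S x') := fun x _ x' _ =>
      NeutralBelief.tvDist_neutralBelief_le hY hS (hpos x₀)
        ((hmin' x).trans (le_max_left _ _))
    have hC : 0 ≤ 2 * NeutralBelief.volLip m Y / volume.real (S x₀) :=
      div_nonneg hL (hpos x₀).le
    refine ⟨hLip.of_le_mul hC hbound, fun _ => ⟨volume (S x₀), ⟨⟨x₀, rfl⟩, ?_⟩, ?_⟩⟩
    · rintro _ ⟨x, rfl⟩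
      simp only
      rw [← hvol x₀, ← hvol x]
      exact ENNReal.ofReal_le_ofReal (hmin' x)
    · refine (NeutralBelief.lipOn_le_mul hC hbound).trans ?_
      rw [NeutralBelief.ofReal_two_mul_volLip_div (hpos x₀), hvol x₀]
      exact ENNReal.mul_div_right_comm.ge
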